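/- All C*-algebras are complex and unital. An operation is a unit-preserving completely positive linear map between C*-algebras. $\mathcal A\otimes\mathcal B$ denotes the minimal C*-tensor product of $\mathcal A$ and $\mathcal B$, i.e. the completion of the algebraic tensor product in the norm $\|t\|_{\min}=\sup_{\pi,\rho}\|(\pi\otimes\rho)(t)\|$, where $\pi$ and $\rho$ run over the unital Hilbert space representations of $\mathcal A$ and $\mathcal B$. A C*-algebra $\mathcal C$ is called injective if for every C*-algebra $\mathcal D$, every injective unital $*$-homomorphism $i:\mathcal D\to\mathcal C$ and every operation $\varphi:\mathcal D\to\mathcal C$ there is an operation $\psi:\mathcal C\to\mathcal C$ with $\psi\circ i=\varphi$. Two unital $*$-homomorphisms $f:\mathcal A\to\mathcal C$ and $g:\mathcal B\to\mathcal C$ are called $Op$-independent if for any two operations $\alpha:\mathcal A\to\mathcal A$ and $\beta:\mathcal B\to\mathcal B$ there is an operation $\gamma:\mathcal C\to\mathcal C$ with $\gamma\circ f=f\circ\alpha$ and $\gamma\circ g=g\circ\beta$. Two C*-subalgebras $\mathcal S,\mathcal T$ of $\mathcal C$ are called $Op$-independent in $\mathcal C$ if $g_1$ and $g_2$ are $Op$-independent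 whenever $g_1:\mathcal D_1\to\mathcal C$ and $g_2:\mathcal D_2\to\mathcal C$ are injective unital $*$-homomorphisms that represent the same subobjects of $\mathcal C$ as the inclusions of $\mathcal S$ and $\mathcal T$, i.e. $g_1=\iota_{\mathcal S}\circ h_1$ and $g_2=\iota_{\mathcal T}\circ h_2$ for some $*$-isomorphisms $h_1:\mathcal D_1\to\mathcal S$ and $h_2:\mathcal D_2\to\mathcal T$. Corollary. Let $\mathcal A$, $\mathcal B$, $\mathcal C$ be C*-algebras, let $\mathcal C$ be injective, and let $\mathcal A\otimes\mathcal B$ be a C*-subalgebra of $\mathcal C$, embedded by an injective unital $*$-homomorphism $j:\mathcal A\otimes\mathcal B\to\mathcal C$. Then $j(\mathcal A\otimes I_{\mathcal B})$ and $j(I_{\mathcal A}\otimes\mathcal B)$ are C*-subalgebras of $\mathcal C$ that are $Op$-independent in $\mathcal C$. Moreover, the homomorphisms $A\mapsto j(A\otimes I_{\mathcal B})$ and $B\mapsto j(I_{\mathcal A}\otimes B)$ are $Op$-independent, so that any two operations on $\mathcal A$ and $\mathcal B$ have a joint extension to an operation on $\mathcal C$, and these homomorphisms are injective if $\mathcal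 A$ and $\mathcal B$ are nonzero (so that $\mathcal A\approx\mathcal A\otimes I_{\mathcal B}$ and $\mathcal B\approx I_{\mathcal A}\otimes\mathcal B$). -/

import Mathlib

open scoped TensorProduct

universe u v w

noncomputable section

namespace CStarIndep

/-! ### Hilbert space tensor products -/

section HilbertTensor

variable {H : Type u} {K : Type v} [NormedAddCommGroup H] [InnerProductSpace ℂ H]
  [NormedAddCommGroup K] [InnerProductSpace ℂ K]

/-- The Hilbert space tensor product: the completion of the algebraic tensor product in the inner
product `⟨x ⊗ y, x' ⊗ y'⟩ = ⟨x, x'⟩ ⟨y, y'⟩`. -/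
def HilbertTensor (H : Type u) (K : Type v) [NormedAddCommGroup H] [InnerProductSpace ℂ H]
    [NormedAddCommGroup K] [InnerProductSpace ℂ K] : Type (max u v) :=
  UniformSpace.Completion (H ⊗[ℂ] K)

instance : NormedAddCommGroup (HilbertTensor H K) :=
  inferInstanceAs (NormedAddCommGroup (UniformSpace.Completion (H ⊗[ℂ] K)))
instance : InnerProductSpace ℂ (HilbertTensor H K) :=
  inferInstanceAs (InnerProductSpace ℂ (UniformSpace.Completion (H ⊗[ℂ] K)))
instance : CompleteSpace (HilbertTensor H K) :=
  inferInstanceAs (CompleteSpace (UniformSpace.Completion (H ⊗[ℂ] K)))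

namespace HilbertTensor

/-- The canonical isometric embedding of the algebraic tensor product. -/
def coe : H ⊗[ℂ] K →ₗ[ℂ] HilbertTensor H K where
  toFun x := (x : UniformSpace.Completion (H ⊗[ℂ] K))
  map_add' x y := UniformSpace.Completion.coe_add x y
  map_smul' c x := UniformSpace.Completion.coe_smul c x

theorem denseRange_coe : DenseRange (coe : H ⊗[ℂ] K → HilbertTensor H K) :=
  UniformSpace.Completion.denseRange_coe

theorem inner_coe_tmul (x x' : H) (y y' : K) :
    inner ℂ (coe (x ⊗ₜ[ℂ] y)) (coe (x' ⊗ₜ[ℂ] y')) = inner ℂ x x' * inner ℂ y y' := by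
  rw [← TensorProduct.inner_tmul]
  exact UniformSpace.Completion.inner_coe _ _

theorem clm_ext {S T : HilbertTensor H K →L[ℂ] HilbertTensor H K}
    (h : ∀ x y, S (coe (x ⊗ₜ[ℂ] y)) = T (coe (x ⊗ₜ[ℂ] y))) : S = T := by
  refine ContinuousLinearMap.ext fun z => ?_
  refine denseRange_coe.induction_on z (isClosed_eq S.continuous T.continuous) fun z => ?_
  induction z using TensorProduct.induction_on with
  | zero => simp
  | tmul x y => exact h x y
  | add x y hx hy => rw [map_add, map_add, map_add, hx, hy]

/-- The bounded operator `S ⊗ T` on the Hilbert space tensor product. -/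
def opTensor (S : H →L[ℂ] H) (T : K →L[ℂ] K) : HilbertTensor H K →L[ℂ] HilbertTensor H K :=
  (TensorProduct.mapL S T).completion

theorem opTensor_coe_tmul (S : H →L[ℂ] H) (T : K →L[ℂ] K) (x : H) (y : K) :
    opTensor S T (coe (x ⊗ₜ[ℂ] y)) = coe (S x ⊗ₜ[ℂ] T y) :=
  ContinuousLinearMap.completion_apply_coe (TensorProduct.mapL S T) (x ⊗ₜ[ℂ] y)

theorem opTensor_star [CompleteSpace H] [CompleteSpace K] (S : H →L[ℂ] H) (T : K →L[ℂ] K) :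
    opTensor (star S) (star T) = star (opTensor S T) := by
  refine clm_ext fun x' y' => ext_inner_left ℂ fun z => ?_
  rw [ContinuousLinearMap.star_eq_adjoint (opTensor S T),
    ContinuousLinearMap.adjoint_inner_right]
  refine denseRange_coe.induction_on z (isClosed_eq (by fun_prop) (by fun_prop)) fun z => ?_
  induction z using TensorProduct.induction_on with
  | zero => simp
  | tmul x y =>
    rw [opTensor_coe_tmul, opTensor_coe_tmul, inner_coe_tmul, inner_coe_tmul,
      ContinuousLinearMap.star_eq_adjoint, ContinuousLinearMap.star_eq_adjoint,
      ContinuousLinearMap.adjoint_inner_right, ContinuousLinearMap.adjoint_inner_right]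
  | add x y hx hy => rw [map_add, map_add, inner_add_left, inner_add_left, hx, hy]

end HilbertTensor

end HilbertTensor

/-! ### The minimal tensor product of two unital C*-algebras -/

/-- A (unital) representation of a unital C*-algebra `A` on a Hilbert space. -/
structure HilbertRep (A : Type u) [CStarAlgebra A] : Type (u + 1) where
  /-- the Hilbert space -/
  space : Type u
  [normedAddCommGroup : NormedAddCommGroup space]
  [innerProductSpace : InnerProductSpace ℂ space]
  [completeSpace : CompleteSpace space]
  /-- the representation -/
  hom : A →⋆ₐ[ℂ] (space →L[ℂ] space)

attribute [instance] HilbertRep.normedAddCommGroup HilbertRep.innerProductSpace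
  HilbertRep.completeSpace

section MinTensor

variable {A : Type u} {B : Type v} [CStarAlgebra A] [CStarAlgebra B]

/-- `tensorRep` as a homomorphism of algebras. -/
def tensorRepAlg (π : HilbertRep A) (ρ : HilbertRep B) :
    A ⊗[ℂ] B →ₐ[ℂ]
      (HilbertTensor π.space ρ.space →L[ℂ] HilbertTensor π.space ρ.space) :=
  Algebra.TensorProduct.algHomOfLinearMapTensorProduct
    (TensorProduct.lift
      (LinearMap.mk₂ ℂ (fun (a : A) (b : B) => HilbertTensor.opTensor (π.hom a) (ρ.hom b))
        (fun a a' b => HilbertTensor.clm_ext fun x y => by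
          simp [HilbertTensor.opTensor_coe_tmul, TensorProduct.add_tmul])
        (fun c a b => HilbertTensor.clm_ext fun x y => by
          rw [HilbertTensor.opTensor_coe_tmul, map_smul, smul_apply,
            smul_apply, HilbertTensor.opTensor_coe_tmul,
            ← TensorProduct.smul_tmul', map_smul])
        (fun a b b' => HilbertTensor.clm_ext fun x y => by
          simp [HilbertTensor.opTensor_coe_tmul, TensorProduct.tmul_add])
        (fun c a b => HilbertTensor.clm_ext fun x y => by
          simp [HilbertTensor.opTensor_coe_tmul])))
    (fun a a' b b' => HilbertTensor.clm_ext fun x y => by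
      simp [HilbertTensor.opTensor_coe_tmul])
    (HilbertTensor.clm_ext fun x y => by simp [HilbertTensor.opTensor_coe_tmul])

theorem tensorRepAlg_tmul (π : HilbertRep A) (ρ : HilbertRep B) (a : A) (b : B) :
    tensorRepAlg π ρ (a ⊗ₜ[ℂ] b) = HilbertTensor.opTensor (π.hom a) (ρ.hom b) := rfl

theorem tensorRepAlg_star (π : HilbertRep A) (ρ : HilbertRep B) (t : A ⊗[ℂ] B) :
    tensorRepAlg π ρ (star t) = star (tensorRepAlg π ρ t) := by
  induction t using TensorProduct.induction_on with
  | zero => rw [star_zero, map_zero, star_zero]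
  | add s t hs ht => rw [star_add, map_add, map_add, star_add, hs, ht]
  | tmul a b =>
    rw [TensorProduct.star_tmul, tensorRepAlg_tmul, tensorRepAlg_tmul,
      ← HilbertTensor.opTensor_star, map_star, map_star]

/-- The representation `π ⊗ ρ` of the algebraic tensor product `A ⊗ B` with
`(π ⊗ ρ)(a ⊗ b) = π(a) ⊗ ρ(b)` on the tensor product of the two Hilbert spaces. -/
def tensorRep (π : HilbertRep A) (ρ : HilbertRep B) :
    A ⊗[ℂ] B →⋆ₐ[ℂ]
      (HilbertTensor π.space ρ.space →L[ℂ] HilbertTensor π.space ρ.space) where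
  toAlgHom := tensorRepAlg π ρ
  map_star' t := tensorRepAlg_star π ρ t

theorem tensorRep_tmul (π : HilbertRep A) (ρ : HilbertRep B) (a : A) (b : B) :
    tensorRep π ρ (a ⊗ₜ[ℂ] b) = HilbertTensor.opTensor (π.hom a) (ρ.hom b) := rfl

/-- The minimal C*-norm of `t` in the algebraic tensor product: the supremum of `‖(π ⊗ ρ)(t)‖`
over all pairs of representations `π` of `A` and `ρ` of `B`. -/
def minNorm (t : A ⊗[ℂ] B) : ℝ := ⨆ p : HilbertRep A × HilbertRep B, ‖tensorRep p.1 p.2 t‖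

theorem exists_bound (t : A ⊗[ℂ] B) :
    ∃ M : ℝ, ∀ p : HilbertRep A × HilbertRep B, ‖tensorRep p.1 p.2 t‖ ≤ M := by
  induction t using TensorProduct.induction_on with
  | zero => exact ⟨0, fun p => by simp⟩
  | tmul a b =>
    refine ⟨‖a‖ * ‖b‖, fun p => ?_⟩
    let f : A →⋆ₐ[ℂ] (HilbertTensor p.1.space p.2.space →L[ℂ] HilbertTensor p.1.space p.2.space) :=
      { (tensorRep p.1 p.2).toAlgHom.comp Algebra.TensorProduct.includeLeft with
        map_star' := fun a => by
          change tensorRep p.1 p.2 (star a ⊗ₜ[ℂ] 1) = star (tensorRep p.1 p.2 (a ⊗ₜ[ℂ] 1))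
          rw [← map_star, TensorProduct.star_tmul, star_one] }
    let g : B →⋆ₐ[ℂ] (HilbertTensor p.1.space p.2.space →L[ℂ] HilbertTensor p.1.space p.2.space) :=
      { (tensorRep p.1 p.2).toAlgHom.comp Algebra.TensorProduct.includeRight with
        map_star' := fun b => by
          change tensorRep p.1 p.2 (1 ⊗ₜ[ℂ] star b) = star (tensorRep p.1 p.2 (1 ⊗ₜ[ℂ] b))
          rw [← map_star, TensorProduct.star_tmul, star_one] }
    have h : tensorRep p.1 p.2 (a ⊗ₜ[ℂ] b) = f a * g b := by
      change _ = tensorRep p.1 p.2 (a ⊗ₜ[ℂ] 1) * tensorRep p.1 p.2 (1 ⊗ₜ[ℂ] b)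
      rw [← map_mul, Algebra.TensorProduct.tmul_mul_tmul, mul_one, one_mul]
    rw [h]
    exact (norm_mul_le _ _).trans (mul_le_mul (NonUnitalStarAlgHom.norm_apply_le f a)
      (NonUnitalStarAlgHom.norm_apply_le g b) (norm_nonneg _) (norm_nonneg _))
  | add x y hx hy =>
    obtain ⟨M, hM⟩ := hx
    obtain ⟨N, hN⟩ := hy
    refine ⟨M + N, fun p => ?_⟩
    rw [map_add]
    exact (norm_add_le _ _).trans (add_le_add (hM p) (hN p))

theorem bddAbove_rep (t : A ⊗[ℂ] B) :
    BddAbove (Set.range fun p : HilbertRep A × HilbertRep B => ‖tensorRep p.1 p.2 t‖) := by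
  obtain ⟨M, hM⟩ := exists_bound t
  exact ⟨M, by rintro _ ⟨p, rfl⟩; exact hM p⟩

theorem norm_tensorRep_le (π : HilbertRep A) (ρ : HilbertRep B) (t : A ⊗[ℂ] B) :
    ‖tensorRep π ρ t‖ ≤ minNorm t :=
  le_ciSup (bddAbove_rep t) (π, ρ)

theorem minNorm_nonneg (t : A ⊗[ℂ] B) : 0 ≤ minNorm t :=
  Real.iSup_nonneg fun _ => norm_nonneg _

theorem minNorm_le {t : A ⊗[ℂ] B} {M : ℝ} (hM : 0 ≤ M)
    (h : ∀ (π : HilbertRep A) (ρ : HilbertRep B), ‖tensorRep π ρ t‖ ≤ M) : minNorm t ≤ M :=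
  Real.iSup_le (fun p => h p.1 p.2) hM

theorem minNorm_zero : minNorm (0 : A ⊗[ℂ] B) = 0 := by simp [minNorm]

theorem minNorm_add_le (s t : A ⊗[ℂ] B) : minNorm (s + t) ≤ minNorm s + minNorm t :=
  minNorm_le (add_nonneg (minNorm_nonneg s) (minNorm_nonneg t)) fun π ρ => by
    rw [map_add]
    exact (norm_add_le _ _).trans (add_le_add (norm_tensorRep_le _ _ _) (norm_tensorRep_le _ _ _))

theorem minNorm_neg (t : A ⊗[ℂ] B) : minNorm (-t) = minNorm t := by simp [minNorm]

theorem minNorm_mul_le (s t : A ⊗[ℂ] B) : minNorm (s * t) ≤ minNorm s * minNorm t :=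
  minNorm_le (mul_nonneg (minNorm_nonneg s) (minNorm_nonneg t)) fun π ρ => by
    rw [map_mul]
    exact (norm_mul_le _ _).trans (mul_le_mul (norm_tensorRep_le _ _ _) (norm_tensorRep_le _ _ _)
      (norm_nonneg _) (minNorm_nonneg _))

theorem minNorm_smul (c : ℂ) (t : A ⊗[ℂ] B) : minNorm (c • t) = ‖c‖ * minNorm t := by
  simp only [minNorm, map_smul, norm_smul]
  exact (Real.mul_iSup_of_nonneg (norm_nonneg c) _).symm

theorem minNorm_star (t : A ⊗[ℂ] B) : minNorm (star t) = minNorm t := by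
  simp only [minNorm, map_star, norm_star]

theorem minNorm_sq_le (t : A ⊗[ℂ] B) : minNorm t * minNorm t ≤ minNorm (star t * t) := by
  have h : minNorm t ≤ √(minNorm (star t * t)) :=
    minNorm_le (Real.sqrt_nonneg _) fun π ρ => Real.le_sqrt_of_sq_le <| by
      refine le_trans (le_of_eq ?_) (norm_tensorRep_le π ρ (star t * t))
      rw [map_mul, map_star, CStarRing.norm_star_mul_self, sq]
  calc minNorm t * minNorm t ≤ √(minNorm (star t * t)) * √(minNorm (star t * t)) :=
        mul_self_le_mul_self (minNorm_nonneg t) h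
    _ = _ := Real.mul_self_sqrt (minNorm_nonneg _)

variable (A B) in
/-- The algebraic tensor product of `A` and `B`, to be equipped with the minimal C*-norm. -/
def AlgTensor : Type (max u v) := A ⊗[ℂ] B

instance : Ring (AlgTensor A B) := inferInstanceAs (Ring (A ⊗[ℂ] B))
instance : Algebra ℂ (AlgTensor A B) := inferInstanceAs (Algebra ℂ (A ⊗[ℂ] B))
instance : StarRing (AlgTensor A B) := inferInstanceAs (StarRing (A ⊗[ℂ] B))
instance : StarModule ℂ (AlgTensor A B) := inferInstanceAs (StarModule ℂ (A ⊗[ℂ] B))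

instance : SeminormedRing (AlgTensor A B) :=
  { (inferInstance : Ring (AlgTensor A B)),
    AddGroupSeminorm.toSeminormedAddCommGroup
      ({ toFun := fun t : AlgTensor A B => minNorm (A := A) (B := B) t
         map_zero' := minNorm_zero
         add_le' := minNorm_add_le
         neg' := minNorm_neg } : AddGroupSeminorm (AlgTensor A B)) with
    norm_mul_le := minNorm_mul_le }

theorem norm_algTensor (t : AlgTensor A B) : ‖t‖ = minNorm (A := A) (B := B) t := rfl

instance : NormedSpace ℂ (AlgTensor A B) where
  norm_smul_le c t := (minNorm_smul (A := A) (B := B) c t).le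

instance : NormedStarGroup (AlgTensor A B) where
  norm_star_le t := (minNorm_star (A := A) (B := B) t).le

variable (A B) in
/-- The minimal C*-tensor product of `A` and `B`: the completion of the algebraic tensor product
in the minimal C*-norm. -/
def MinTensor : Type (max u v) := UniformSpace.Completion (AlgTensor A B)

namespace MinTensor

instance : NormedRing (MinTensor A B) :=
  inferInstanceAs (NormedRing (UniformSpace.Completion (AlgTensor A B)))
instance : CompleteSpace (MinTensor A B) :=
  inferInstanceAs (CompleteSpace (UniformSpace.Completion (AlgTensor A B)))
instance : Algebra ℂ (MinTensor A B) :=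
  inferInstanceAs (Algebra ℂ (UniformSpace.Completion (AlgTensor A B)))
instance : NormedAlgebra ℂ (MinTensor A B) where
  norm_smul_le c x := norm_smul_le (β := UniformSpace.Completion (AlgTensor A B)) c x

/-- The canonical map from the algebraic tensor product to the minimal tensor product. -/
def of (t : AlgTensor A B) : MinTensor A B := (t : UniformSpace.Completion (AlgTensor A B))

theorem induction {p : MinTensor A B → Prop} (x : MinTensor A B) (hp : IsClosed {x | p x})
    (h : ∀ t, p (of t)) : p x :=
  UniformSpace.Completion.induction_on x hp h

theorem induction₂ {p : MinTensor A B → MinTensor A B → Prop} (x y : MinTensor A B)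
    (hp : IsClosed {q : MinTensor A B × MinTensor A B | p q.1 q.2})
    (h : ∀ s t, p (of s) (of t)) : p x y :=
  UniformSpace.Completion.induction_on₂ x y hp h

theorem of_add (s t : AlgTensor A B) : of (s + t) = of s + of t :=
  UniformSpace.Completion.coe_add s t
theorem of_mul (s t : AlgTensor A B) : of (s * t) = of s * of t :=
  UniformSpace.Completion.coe_mul s t
theorem of_smul (c : ℂ) (t : AlgTensor A B) : of (c • t) = c • of t :=
  UniformSpace.Completion.coe_smul c t
theorem norm_of (t : AlgTensor A B) : ‖of t‖ = minNorm (A := A) (B := B) t :=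
  UniformSpace.Completion.norm_coe t

theorem uniformContinuous_star : UniformContinuous (star : AlgTensor A B → AlgTensor A B) :=
  starNormedAddGroupHom.uniformContinuous

/-- The involution is the continuous extension of the one on the algebraic tensor product. -/
instance : Star (MinTensor A B) where
  star x := UniformSpace.Completion.map (star : AlgTensor A B → AlgTensor A B) x

theorem star_of (t : AlgTensor A B) : star (of t) = of (star t) :=
  UniformSpace.Completion.map_coe uniformContinuous_star t

theorem continuous_star : Continuous (star : MinTensor A B → MinTensor A B) :=
  UniformSpace.Completion.continuous_map

instance : StarRing (MinTensor A B) where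
  star_involutive x := by
    refine induction (p := fun x => star (star x) = x) x (isClosed_eq (f := fun x : MinTensor A B => star (star x))
      (continuous_star.comp continuous_star) continuous_id) ?_
    intro t
    rw [star_of, star_of, star_star]
  star_mul x y := by
    refine induction₂ (p := fun x y => star (x * y) = star y * star x) x y (isClosed_eq
      (f := fun q : MinTensor A B × MinTensor A B => star (q.1 * q.2))
      (g := fun q : MinTensor A B × MinTensor A B => star q.2 * star q.1)
      (continuous_star.comp continuous_mul)
      ((continuous_star.comp continuous_snd).mul (continuous_star.comp continuous_fst))) ?_
    intro s t
    rw [← of_mul, star_of, star_of, star_of, ← of_mul, star_mul]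
  star_add x y := by
    refine induction₂ (p := fun x y => star (x + y) = star x + star y) x y (isClosed_eq
      (f := fun q : MinTensor A B × MinTensor A B => star (q.1 + q.2))
      (g := fun q : MinTensor A B × MinTensor A B => star q.1 + star q.2)
      (continuous_star.comp continuous_add)
      ((continuous_star.comp continuous_fst).add (continuous_star.comp continuous_snd))) ?_
    intro s t
    rw [← of_add, star_of, star_of, star_of, ← of_add, star_add]

instance : StarModule ℂ (MinTensor A B) where
  star_smul c x := by
    refine induction (p := fun x => star (c • x) = star c • star x) x (isClosed_eq
      (f := fun x : MinTensor A B => star (c • x))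
      (g := fun x : MinTensor A B => star c • star x)
      (continuous_star.comp (continuous_const_smul c))
      (continuous_star.const_smul (star c))) ?_
    intro t
    rw [← of_smul, star_of, star_of, ← of_smul, star_smul]

instance : CStarRing (MinTensor A B) where
  norm_mul_self_le x := by
    refine induction (p := fun x => ‖x‖ * ‖x‖ ≤ ‖star x * x‖) x (isClosed_le
      (f := fun x : MinTensor A B => ‖x‖ * ‖x‖)
      (g := fun x : MinTensor A B => ‖star x * x‖)
      (continuous_norm.mul continuous_norm)
      (continuous_norm.comp (continuous_star.mul continuous_id))) ?_
    intro t
    rw [star_of, ← of_mul, norm_of, norm_of]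
    exact minNorm_sq_le (A := A) (B := B) t

instance : CStarAlgebra (MinTensor A B) where

variable (A B) in
/-- The canonical unital *-homomorphism from the algebraic tensor product. -/
def ofHom : AlgTensor A B →⋆ₐ[ℂ] MinTensor A B where
  toFun := of
  map_one' := rfl
  map_mul' := of_mul
  map_zero' := rfl
  map_add' := of_add
  commutes' _ := rfl
  map_star' t := (star_of t).symm

variable (A B) in
/-- The canonical *-homomorphism `a ↦ a ⊗ 1`. -/
def inl : A →⋆ₐ[ℂ] MinTensor A B where
  __ := (ofHom A B).toAlgHom.comp
    (Algebra.TensorProduct.includeLeft : A →ₐ[ℂ] A ⊗[ℂ] B)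
  map_star' a := by
    refine (congrArg of ?_).trans (star_of (A := A) (B := B) (a ⊗ₜ[ℂ] (1 : B) : A ⊗[ℂ] B)).symm
    exact (congrArg (fun b : B => star a ⊗ₜ[ℂ] b) (star_one B).symm :
      star a ⊗ₜ[ℂ] (1 : B) = star (a ⊗ₜ[ℂ] (1 : B)))

variable (A B) in
/-- The canonical *-homomorphism `b ↦ 1 ⊗ b`. -/
def inr : B →⋆ₐ[ℂ] MinTensor A B where
  __ := (ofHom A B).toAlgHom.comp
    (Algebra.TensorProduct.includeRight : B →ₐ[ℂ] A ⊗[ℂ] B)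
  map_star' b := by
    refine (congrArg of ?_).trans (star_of (A := A) (B := B) ((1 : A) ⊗ₜ[ℂ] b : A ⊗[ℂ] B)).symm
    exact (congrArg (fun a : A => a ⊗ₜ[ℂ] star b) (star_one A).symm :
      (1 : A) ⊗ₜ[ℂ] star b = star ((1 : A) ⊗ₜ[ℂ] b))

theorem inl_apply (a : A) : inl A B a = of (a ⊗ₜ[ℂ] (1 : B)) := rfl
theorem inr_apply (b : B) : inr A B b = of ((1 : A) ⊗ₜ[ℂ] b) := rfl

end MinTensor

end MinTensor

/-! ### Operations, injectivity and independence -/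

section Operations

attribute [local instance] CStarAlgebra.spectralOrder CStarAlgebra.spectralOrderedRing

/-- A (non-selective) operation: a unit-preserving completely positive linear map between unital
C*-algebras. Positivity refers to the C*-order (selfadjoint with nonnegative spectrum). -/
structure Operation (A : Type u) (B : Type v) [CStarAlgebra A] [CStarAlgebra B] extends
    CompletelyPositiveMap A B where
  map_one' : toFun 1 = 1

instance {A : Type u} {B : Type v} [CStarAlgebra A] [CStarAlgebra B] :
    CoeFun (Operation A B) (fun _ => A → B) where
  coe φ := φ.toFun

end Operations

/-- `Q` is injective: any operation into `Q` from a C*-algebra `D` that is embedded in `Q` by an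
injective unital *-homomorphism extends along the embedding to an operation on `Q`. -/
def IsOpInjective (Q : Type w) [CStarAlgebra Q] : Prop :=
  ∀ (D : Type w) [CStarAlgebra D] (i : D →⋆ₐ[ℂ] Q), Function.Injective i →
    ∀ φ : Operation D Q, ∃ ψ : Operation Q Q, ∀ d : D, ψ (i d) = φ d

/-- Two *-homomorphisms into `C` are independent with respect to operations: any two operations on
their domains are jointly implemented by one operation on `C`. -/
def OpIndependentHoms {A : Type u} {B : Type v} {C : Type w}
    [CStarAlgebra A] [CStarAlgebra B] [CStarAlgebra C]
    (f : A →⋆ₐ[ℂ] C) (g : B →⋆ₐ[ℂ] C) : Prop :=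
  ∀ (α : Operation A A) (β : Operation B B), ∃ γ : Operation C C,
    (∀ a : A, γ (f a) = f (α a)) ∧ (∀ b : B, γ (g b) = g (β b))

/-- `g` and `f` represent the same subobject of `C`: there is a *-isomorphism `h` of their domains
with `f ∘ h = g`. -/
def SameSubobject {D A C : Type w} [CStarAlgebra D] [CStarAlgebra A] [CStarAlgebra C]
    (g : D →⋆ₐ[ℂ] C) (f : A →⋆ₐ[ℂ] C) : Prop :=
  ∃ h : D ≃⋆ₐ[ℂ] A, ∀ d : D, f (h d) = g d

/-- The subobjects of `C` represented by `f₁` and `f₂` are independent with respect to operations: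
all their representatives are. -/
def OpIndependentSubobjects {A B C : Type w} [CStarAlgebra A] [CStarAlgebra B] [CStarAlgebra C]
    (f₁ : A →⋆ₐ[ℂ] C) (f₂ : B →⋆ₐ[ℂ] C) : Prop :=
  ∀ (D₁ D₂ : Type w) [CStarAlgebra D₁] [CStarAlgebra D₂]
    (g₁ : D₁ →⋆ₐ[ℂ] C) (g₂ : D₂ →⋆ₐ[ℂ] C),
    Function.Injective g₁ → Function.Injective g₂ →
    SameSubobject g₁ f₁ → SameSubobject g₂ f₂ → OpIndependentHoms g₁ g₂

/-- The *-subalgebras `S` and `T` of `C` are C*-subalgebras (norm closed), and they are independent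
with respect to operations as subobjects of `C`. -/
def OpIndependent {C : Type w} [CStarAlgebra C] (S T : StarSubalgebra ℂ C) : Prop :=
  ∃ (_ : IsClosed (S : Set C)) (_ : IsClosed (T : Set C)),
    OpIndependentSubobjects S.subtype T.subtype

end CStarIndep

end

noncomputable section

/-! Given operations `α` on `A` and `β` on `B`, form the operation `α ⊗ β` on the minimal tensor
product and use injectivity of `C` to extend `j ∘ (α ⊗ β)` along `j`. The extension `γ` satisfies `γ
(j (a ⊗ 1)) = j (α a ⊗ β 1) = j (α a ⊗ 1)` because `β` is unital, and symmetrically on `1 ⊗ B`. All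
the weight lies in the existence and complete positivity of `α ⊗ β` (`Operation.tensor`).

This comes from Stinespring's theorem (`Operation.exists_dilation`). For representations `π`, `ρ` of
the target algebras, `π ∘ α = V* σ V` and `ρ ∘ β = W* τ W` with isometries `V`, `W`, so `(π ⊗ ρ) ∘
(α ⊗ β)` is the compression of `σ ⊗ τ` by `V ⊗ W`. Hence `α ⊗ β` is contractive for the minimal norm
(`minNorm_map_le`) and extends to the completion. The same identity carries positive matrices to
matrices whose quadratic forms under every `π ⊗ ρ` are nonnegative, and these forms detect
positivity (`minTensor_matrix_nonneg`).

To pass from the two homomorphisms to their ranges, `a ↦ a ⊗ 1` and `b ↦ 1 ⊗ b` must be injective.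
For nonzero algebras this follows from the GNS construction (`MinTensor.of_tmul_ne_zero`); if `A` or
`B` is zero, then `C` is zero and nothing remains to prove. -/

namespace CStarIndep

open scoped ComplexOrder

attribute [local instance] CStarAlgebra.spectralOrder CStarAlgebra.spectralOrderedRing

/-! ### Detecting positivity by positive functionals. -/

section PositivityCriterion

/-- Positivity in a C*-algebra is detected by any separating family of positive functionals that is
stable under compressions. -/
theorem nonneg_of_forall_functional {M : Type*} [NonUnitalCStarAlgebra M] [PartialOrder M]
    [StarOrderedRing M] {ι : Type*} (q : ι → M →ₚ[ℂ] ℂ)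
    (hcomp : ∀ i y, ∃ i', ∀ x, q i' x = q i (star y * x * y))
    (hsep : ∀ x, (∀ i, q i x = 0) → x = 0) {x : M} (hx : ∀ i, 0 ≤ q i x) : 0 ≤ x := by
  have hsa : IsSelfAdjoint x := by
    refine sub_eq_zero.mp (hsep _ fun i => ?_)
    rw [map_sub, map_star, (IsSelfAdjoint.of_nonneg (hx i)).star_eq, sub_self]
  have hneg : 0 ≤ x⁻ := CFC.negPart_nonneg x
  have hnsa : star x⁻ = x⁻ := (IsSelfAdjoint.of_nonneg hneg).star_eq
  -- Compressing by the negative part kills `x⁺`. The compressed functional is again in the family,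
  -- so each `q i` is both nonnegative and nonpositive on the cube of `x⁻`.
  have hcube : x⁻ * x * x⁻ = -(x⁻ * x⁻ * x⁻) := by
    have := congrArg (fun z => x⁻ * z * x⁻) (CFC.posPart_sub_negPart x hsa)
    simp only [mul_sub, CFC.negPart_mul_posPart, zero_sub, neg_mul] at this
    exact this.symm
  have hcube_nonneg : 0 ≤ x⁻ * x⁻ * x⁻ := by
    simpa [hnsa] using star_left_conjugate_nonneg hneg x⁻
  have h3 : x⁻ * x⁻ * x⁻ = 0 := hsep _ fun i => by
    refine le_antisymm ?_ (map_nonneg (q i) hcube_nonneg)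
    obtain ⟨i', hi'⟩ := hcomp i x⁻
    have := hx i'
    rw [hi', hnsa, hcube, map_neg] at this
    exact neg_nonneg.mp this
  have h2 : x⁻ * x⁻ = 0 := by
    rw [← CStarRing.star_mul_self_eq_zero_iff, star_mul, hnsa, ← mul_assoc, h3, zero_mul]
  have h1 : x⁻ = 0 := by
    rw [← CStarRing.star_mul_self_eq_zero_iff, hnsa, h2]
  rw [← CFC.posPart_sub_negPart x hsa, h1, sub_zero]
  exact CFC.posPart_nonneg x

theorem exists_eq_star_mul_self {M : Type*} [NonUnitalCStarAlgebra M] [PartialOrder M]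
    [StarOrderedRing M] {x : M} (hx : 0 ≤ x) : ∃ y, x = star y * y :=
  CStarAlgebra.nonneg_iff_eq_star_mul_self.mp hx

end PositivityCriterion

/-! ### Quadratic forms of operator matrices. -/

section QuadraticForm

variable {A : Type*} [CStarAlgebra A] {H : Type*} [NormedAddCommGroup H] [InnerProductSpace ℂ H]
  [CompleteSpace H] {n : Type*} [Fintype n]

/-- Compressing the matrix by `Y` amounts to moving the vector tuple by `π(Y)`. With `M = 1` this
gives positivity of the form; for general `M` it shows that these functionals are stable under
compressions. -/
theorem matrixForm_star_mul (π : A →⋆ₐ[ℂ] (H →L[ℂ] H)) (x : n → H) (M Y : CStarMatrix n n A) :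
    ∑ i, ∑ j, inner ℂ (x i) (π ((star Y * M * Y) i j) (x j)) =
      ∑ i, ∑ j, inner ℂ (∑ k, π (Y i k) (x k)) (π (M i j) (∑ k, π (Y j k) (x k))) := by
  have key : ∀ i j, inner ℂ (x i) (π ((star Y * M * Y) i j) (x j)) =
      ∑ l, ∑ k, inner ℂ (π (Y k i) (x i)) (π (M k l) (π (Y l j) (x j))) := by
    intro i j
    rw [CStarMatrix.mul_apply, map_sum, sum_apply, inner_sum]
    refine Finset.sum_congr rfl fun l _ => ?_
    rw [CStarMatrix.mul_apply, Finset.sum_mul, map_sum, sum_apply, inner_sum]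
    refine Finset.sum_congr rfl fun k _ => ?_
    rw [CStarMatrix.star_apply, map_mul, map_mul, map_star, ContinuousLinearMap.star_eq_adjoint]
    simp only [mul_apply_eq_comp, ContinuousLinearMap.adjoint_inner_right]
  simp only [key, map_sum, sum_inner, inner_sum]
  calc ∑ i, ∑ j, ∑ l, ∑ k, inner ℂ (π (Y k i) (x i)) (π (M k l) (π (Y l j) (x j)))
      = ∑ i, ∑ l, ∑ j, ∑ k, inner ℂ (π (Y k i) (x i)) (π (M k l) (π (Y l j) (x j))) :=
        Finset.sum_congr rfl fun _ _ => Finset.sum_comm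
    _ = ∑ l, ∑ i, ∑ k, ∑ j, inner ℂ (π (Y k i) (x i)) (π (M k l) (π (Y l j) (x j))) := by
        rw [Finset.sum_comm]
        exact Finset.sum_congr rfl fun _ _ => Finset.sum_congr rfl fun _ _ => Finset.sum_comm
    _ = ∑ l, ∑ k, ∑ i, ∑ j, inner ℂ (π (Y k i) (x i)) (π (M k l) (π (Y l j) (x j))) :=
        Finset.sum_congr rfl fun _ _ => Finset.sum_comm
    _ = ∑ k, ∑ l, ∑ i, ∑ j, inner ℂ (π (Y k i) (x i)) (π (M k l) (π (Y l j) (x j))) :=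
        Finset.sum_comm
    _ = _ := Finset.sum_congr rfl fun _ _ => Finset.sum_congr rfl fun _ _ => Finset.sum_comm

theorem matrixForm_nonneg (π : A →⋆ₐ[ℂ] (H →L[ℂ] H)) (x : n → H) {M : CStarMatrix n n A}
    (hM : 0 ≤ M) : 0 ≤ ∑ i, ∑ j, inner ℂ (x i) (π (M i j) (x j)) := by
  classical
  obtain ⟨Y, rfl⟩ := exists_eq_star_mul_self hM
  have := matrixForm_star_mul π x 1 Y
  rw [mul_one] at this
  rw [this]
  refine Finset.sum_nonneg fun i _ => ?_
  rw [Finset.sum_eq_single i]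
  · rw [CStarMatrix.one_apply_eq, map_one]
    rw [one_apply_eq_self, inner_self_eq_norm_sq_to_K]
    exact pow_nonneg (RCLike.ofReal_nonneg.mpr (norm_nonneg _)) 2
  · intro j _ hj
    rw [CStarMatrix.one_apply_ne hj.symm, map_zero]
    simp
  · simp

/-- The positive functional on matrices over `A` given by a representation of `A` and a tuple of
vectors. -/
def matrixFunctional (π : A →⋆ₐ[ℂ] (H →L[ℂ] H)) (x : n → H) : CStarMatrix n n A →ₚ[ℂ] ℂ :=
  PositiveLinearMap.mk₀
    { toFun := fun M => ∑ i, ∑ j, inner ℂ (x i) (π (M i j) (x j))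
      map_add' := fun M N => by
        simp [Finset.sum_add_distrib]
      map_smul' := fun c M => by
        simp [Finset.mul_sum] }
    fun _ hM => matrixForm_nonneg π x hM

theorem matrixFunctional_apply (π : A →⋆ₐ[ℂ] (H →L[ℂ] H)) (x : n → H) (M : CStarMatrix n n A) :
    matrixFunctional π x M = ∑ i, ∑ j, inner ℂ (x i) (π (M i j) (x j)) := rfl

/-- By complex polarization, an operator with vanishing quadratic form is zero. -/
theorem matrix_eq_zero_of_matrixFunctional (π : A →⋆ₐ[ℂ] (H →L[ℂ] H)) {M : CStarMatrix n n A}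
    (h : ∀ x : n → H, matrixFunctional π x M = 0) (i j : n) : π (M i j) = 0 := by
  classical
  -- the matrix acts on the Hilbert sum of copies of `H`
  let T : PiLp 2 (fun _ : n => H) →ₗ[ℂ] PiLp 2 (fun _ : n => H) :=
    { toFun := fun x => WithLp.toLp 2 fun i => ∑ j, π (M i j) (x j)
      map_add' := fun x y => by ext i; simp [Finset.sum_add_distrib]
      map_smul' := fun c x => by ext i; simp [Finset.smul_sum] }
  have hT : T = 0 := by
    refine (inner_map_self_eq_zero T).mp fun x => ?_
    rw [← inner_conj_symm, PiLp.inner_apply]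
    have := h fun i => x i
    simp only [matrixFunctional_apply] at this
    simp only [T, LinearMap.coe_mk, AddHom.coe_mk, inner_sum, this, map_zero]
  ext y
  have := congrArg (fun S => S (WithLp.toLp 2 (Pi.single j y)) i) hT
  simpa [T, Pi.single_apply, apply_ite] using this

end QuadraticForm

/-! ### Stinespring dilation of a positive kernel. -/

section Stinespring

/-- A linear map from a C*-algebra to bounded operators whose kernel `(a, b) ↦ φ (a* b)` is
hermitian and positive semidefinite, i.e. a completely positive map in Stinespring's sense. -/
structure IsPositiveKernel {A : Type u} [CStarAlgebra A] {H : Type v} [NormedAddCommGroup H]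
    [InnerProductSpace ℂ H] [CompleteSpace H] (φ : A →ₗ[ℂ] (H →L[ℂ] H)) : Prop where
  map_star : ∀ a, φ (star a) = star (φ a)
  nonneg : ∀ (n : ℕ) (a : Fin n → A) (x : Fin n → H),
    0 ≤ ∑ i, ∑ j, inner ℂ (x i) (φ (star (a i) * a j) (x j))

namespace IsPositiveKernel

variable {A : Type u} [CStarAlgebra A] {H : Type v} [NormedAddCommGroup H]
  [InnerProductSpace ℂ H] {φ : A →ₗ[ℂ] (H →L[ℂ] H)}

/-- Stinespring's sesquilinear form `⟨a ⊗ x, b ⊗ y⟩ = ⟨x, φ (a* b) y⟩`. -/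
def form (φ : A →ₗ[ℂ] (H →L[ℂ] H)) : A ⊗[ℂ] H →ₗ⋆[ℂ] A ⊗[ℂ] H →ₗ[ℂ] ℂ :=
  TensorProduct.lift <| LinearMap.mk₂'ₛₗ (starRingEnd ℂ) (starRingEnd ℂ)
    (fun a x => TensorProduct.lift <| LinearMap.mk₂ ℂ
      (fun b y => inner ℂ x (φ (star a * b) y))
      (fun b b' y => by simp [mul_add])
      (fun c b y => by simp)
      (fun b y y' => by simp)
      (fun c b y => by simp))
    (fun a a' x => by ext; simp [add_mul])
    (fun c a x => by ext; simp)
    (fun a x x' => by ext; simp)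
    (fun c a x => by ext; simp [mul_comm])

theorem form_tmul (φ : A →ₗ[ℂ] (H →L[ℂ] H)) (a b : A) (x y : H) :
    form φ (a ⊗ₜ x) (b ⊗ₜ y) = inner ℂ x (φ (star a * b) y) := rfl

theorem form_mulLeft (φ : A →ₗ[ℂ] (H →L[ℂ] H)) (c : A) (s t : A ⊗[ℂ] H) :
    form φ s ((LinearMap.mulLeft ℂ c).rTensor H t) =
      form φ ((LinearMap.mulLeft ℂ (star c)).rTensor H s) t := by
  induction s using TensorProduct.induction_on with
  | zero => simp
  | add s s' hs hs' => simp [hs, hs']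
  | tmul a x =>
    induction t using TensorProduct.induction_on with
    | zero => simp
    | add t t' ht ht' => simp [ht, ht']
    | tmul b y => simp [form_tmul, mul_assoc]

variable [CompleteSpace H]

theorem form_conj (hφ : IsPositiveKernel φ) (s t : A ⊗[ℂ] H) :
    starRingEnd ℂ (form φ t s) = form φ s t := by
  induction s using TensorProduct.induction_on with
  | zero => simp
  | add s s' hs hs' => simp [hs, hs']
  | tmul a x =>
    induction t using TensorProduct.induction_on with
    | zero => simp
    | add t t' ht ht' => simp [ht, ht']
    | tmul b y =>
      rw [form_tmul, form_tmul, inner_conj_symm, ← ContinuousLinearMap.adjoint_inner_right,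
        ← ContinuousLinearMap.star_eq_adjoint, ← hφ.map_star, star_mul, star_star]

/-- Writing `s` as a finite sum of elementary tensors turns the form into the double sum in
`IsPositiveKernel.nonneg`. -/
theorem form_self_nonneg (hφ : IsPositiveKernel φ) (s : A ⊗[ℂ] H) : 0 ≤ form φ s s := by
  obtain ⟨S, rfl⟩ := TensorProduct.exists_finset s
  have := hφ.nonneg S.card (fun i => (S.equivFin.symm i).1.1) (fun i => (S.equivFin.symm i).1.2)
  convert this using 1
  have key : ∑ i ∈ S, i.1 ⊗ₜ[ℂ] i.2 =
      ∑ i : Fin S.card, (S.equivFin.symm i).1.1 ⊗ₜ[ℂ] (S.equivFin.symm i).1.2 := by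
    rw [← Finset.sum_coe_sort, ← S.equivFin.symm.sum_comp]
  rw [key]
  simp only [map_sum, LinearMap.sum_apply, form_tmul]
  exact Finset.sum_comm

/-- Since `‖c‖² - c* c` is positive, it equals `d* d`, and the difference of the two sides is the
form of `d s` with itself. This makes left multiplication bounded on the pre-Hilbert space. -/
theorem form_mulLeft_self_le (hφ : IsPositiveKernel φ) (c : A) (s : A ⊗[ℂ] H) :
    form φ ((LinearMap.mulLeft ℂ c).rTensor H s) ((LinearMap.mulLeft ℂ c).rTensor H s) ≤
      ‖c‖ ^ 2 * form φ s s := by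
  have hle : 0 ≤ algebraMap ℝ A (‖c‖ ^ 2) - star c * c :=
    sub_nonneg.mpr CStarAlgebra.star_mul_le_algebraMap_norm_sq
  obtain ⟨d, hd⟩ := exists_eq_star_mul_self hle
  have h1 : ∀ b : A, form φ ((LinearMap.mulLeft ℂ b).rTensor H s)
      ((LinearMap.mulLeft ℂ b).rTensor H s) =
        form φ s ((LinearMap.mulLeft ℂ (star b * b)).rTensor H s) := fun b => by
    rw [LinearMap.mulLeft_mul, LinearMap.rTensor_comp, LinearMap.comp_apply,
      form_mulLeft φ (star b), star_star]
  have h2 := form_self_nonneg hφ ((LinearMap.mulLeft ℂ d).rTensor H s)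
  have h3 : LinearMap.mulLeft ℂ (star d * d) =
      (‖c‖ ^ 2 : ℂ) • LinearMap.id - LinearMap.mulLeft ℂ (star c * c) := by
    rw [← hd]
    ext b
    simp [sub_mul, mul_assoc, Algebra.algebraMap_eq_smul_one, ← Complex.coe_smul]
  rw [h1, h3, LinearMap.rTensor_sub, LinearMap.rTensor_smul, LinearMap.rTensor_id] at h2
  rw [h1]
  simpa using h2

/-- The algebraic tensor product `A ⊗ H` with Stinespring's semi-inner product. -/
@[nolint unusedArguments]
def PreDilation (_ : IsPositiveKernel φ) : Type (max u v) := A ⊗[ℂ] H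

variable (hφ : IsPositiveKernel φ)

instance : AddCommGroup hφ.PreDilation := inferInstanceAs (AddCommGroup (A ⊗[ℂ] H))
instance : Module ℂ hφ.PreDilation := inferInstanceAs (Module ℂ (A ⊗[ℂ] H))

/-- The semi-inner product of Stinespring's construction. -/
abbrev preInnerCore : PreInnerProductSpace.Core ℂ hφ.PreDilation where
  inner s t := form φ s t
  conj_inner_symm s t := form_conj hφ s t
  re_inner_nonneg s := (RCLike.nonneg_iff.mp (form_self_nonneg hφ s)).1
  add_left s t r := LinearMap.map_add₂ (form φ) s t r
  smul_left s t c := LinearMap.map_smulₛₗ₂ (form φ) c s t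

instance : SeminormedAddCommGroup hφ.PreDilation :=
  InnerProductSpace.Core.toSeminormedAddCommGroup (c := hφ.preInnerCore)
instance : InnerProductSpace ℂ hφ.PreDilation := InnerProductSpace.ofCore hφ.preInnerCore

/-- The identity of the algebraic tensor product, as a map into the pre-Hilbert space. -/
def toPreDilation : A ⊗[ℂ] H →ₗ[ℂ] hφ.PreDilation := LinearMap.id

/-- Left multiplication on Stinespring's pre-Hilbert space, as a linear map. -/
def preMul (c : A) : hφ.PreDilation →ₗ[ℂ] hφ.PreDilation :=
  ((LinearMap.mulLeft ℂ c).rTensor H : A ⊗[ℂ] H →ₗ[ℂ] A ⊗[ℂ] H)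

/-- Left multiplication on Stinespring's pre-Hilbert space. -/
def preHom (c : A) : hφ.PreDilation →L[ℂ] hφ.PreDilation :=
  LinearMap.mkContinuous (hφ.preMul c) ‖c‖ fun s => by
    have h : (inner ℂ (hφ.preMul c s) (hφ.preMul c s) : ℂ) ≤ ‖c‖ ^ 2 * inner ℂ s s :=
      form_mulLeft_self_le hφ c s
    simp only [inner_self_eq_norm_sq_to_K, RCLike.ofReal_eq_complex_ofReal] at h
    rw [← sq_le_sq₀ (norm_nonneg _) (mul_nonneg (norm_nonneg _) (norm_nonneg _)), mul_pow]
    exact_mod_cast h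

theorem preHom_inner (c : A) (s t : hφ.PreDilation) :
    inner ℂ s (hφ.preHom c t) = inner ℂ (hφ.preHom (star c) s) t :=
  form_mulLeft φ c s t

theorem preHom_apply (c : A) (s : hφ.PreDilation) :
    hφ.preHom c s = ((LinearMap.mulLeft ℂ c).rTensor H (s : A ⊗[ℂ] H) : A ⊗[ℂ] H) := rfl

/-- Stinespring's representation. -/
def dilationHom : A →⋆ₐ[ℂ] (UniformSpace.Completion hφ.PreDilation →L[ℂ]
    UniformSpace.Completion hφ.PreDilation) where
  -- The completion is Hausdorff, so it also divides out the null vectors of the semi-inner product.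
  toFun c := (hφ.preHom c).completion
  map_one' := by
    ext s
    induction s using UniformSpace.Completion.induction_on with
    | hp => apply isClosed_eq <;> fun_prop
    | ih s =>
      rw [ContinuousLinearMap.completion_apply_coe, preHom_apply, LinearMap.mulLeft_one,
        LinearMap.rTensor_id]
      rfl
  map_mul' c d := by
    ext s
    induction s using UniformSpace.Completion.induction_on with
    | hp => apply isClosed_eq <;> fun_prop
    | ih s =>
      rw [mul_apply_eq_comp]
      simp only [ContinuousLinearMap.completion_apply_coe]
      rw [preHom_apply, LinearMap.mulLeft_mul, LinearMap.rTensor_comp]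
      rfl
  map_zero' := by
    ext s
    induction s using UniformSpace.Completion.induction_on with
    | hp => apply isClosed_eq <;> fun_prop
    | ih s =>
      rw [ContinuousLinearMap.completion_apply_coe, preHom_apply, LinearMap.mulLeft_zero_eq_zero,
        LinearMap.rTensor_zero]
      rfl
  map_add' c d := by
    ext s
    induction s using UniformSpace.Completion.induction_on with
    | hp => apply isClosed_eq <;> fun_prop
    | ih s =>
      have h : LinearMap.mulLeft ℂ (c + d) = LinearMap.mulLeft ℂ c + LinearMap.mulLeft ℂ d := by
        ext; simp [add_mul]
      rw [add_apply]
      simp only [ContinuousLinearMap.completion_apply_coe]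
      rw [preHom_apply, h, LinearMap.rTensor_add]
      exact UniformSpace.Completion.coe_add _ _
  commutes' z := by
    ext s
    induction s using UniformSpace.Completion.induction_on with
    | hp => apply isClosed_eq <;> fun_prop
    | ih s =>
      have h : LinearMap.mulLeft ℂ (algebraMap ℂ A z) = z • LinearMap.id := by
        ext; simp [Algebra.algebraMap_eq_smul_one]
      rw [ContinuousLinearMap.completion_apply_coe, preHom_apply, h, LinearMap.rTensor_smul,
        LinearMap.rTensor_id, Algebra.algebraMap_eq_smul_one]
      exact UniformSpace.Completion.coe_smul z s
  map_star' c := by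
    refine (ContinuousLinearMap.eq_adjoint_iff _ _).mpr fun s t => ?_
    induction s, t using UniformSpace.Completion.induction_on₂ with
    | hp => apply isClosed_eq <;> fun_prop
    | ih s t =>
      simp only [ContinuousLinearMap.completion_apply_coe, UniformSpace.Completion.inner_coe]
      exact (preHom_inner hφ c s t).symm

/-- Stinespring's isometry `x ↦ 1 ⊗ x`. -/
def dilationIsometry (h1 : φ 1 = 1) : H →ₗᵢ[ℂ] UniformSpace.Completion hφ.PreDilation :=
  LinearMap.isometryOfInner
    { toFun := fun x => (hφ.toPreDilation ((1 : A) ⊗ₜ[ℂ] x) : UniformSpace.Completion hφ.PreDilation)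
      map_add' := fun x y => by
        rw [TensorProduct.tmul_add, map_add]
        exact UniformSpace.Completion.coe_add _ _
      map_smul' := fun c x => by
        rw [TensorProduct.tmul_smul, map_smul]
        exact UniformSpace.Completion.coe_smul _ _ }
    fun x y => by
      refine (UniformSpace.Completion.inner_coe _ _).trans ?_
      -- The form here is `⟨x, φ(1) y⟩`, so unitality is exactly what makes the map isometric.
      change form φ ((1 : A) ⊗ₜ[ℂ] x) ((1 : A) ⊗ₜ[ℂ] y) = _
      rw [form_tmul, star_one, mul_one, h1, one_apply_eq_self]

theorem inner_dilationIsometry (h1 : φ 1 = 1) (a : A) (x y : H) :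
    inner ℂ (hφ.dilationIsometry h1 x) (hφ.dilationHom a (hφ.dilationIsometry h1 y)) =
      inner ℂ x (φ a y) := by
  refine Eq.trans (congrArg _ (ContinuousLinearMap.completion_apply_coe _ _)) ?_
  refine (UniformSpace.Completion.inner_coe _ _).trans ?_
  change form φ ((1 : A) ⊗ₜ[ℂ] x) ((a * 1) ⊗ₜ[ℂ] y) = _
  rw [form_tmul, star_one, one_mul, mul_one]

end IsPositiveKernel

end Stinespring

/-! ### Operations, their composition, and their dilations. -/

namespace Operation

section Basic

variable {A : Type u} {B : Type v} {C : Type w} [CStarAlgebra A] [CStarAlgebra B] [CStarAlgebra C]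

theorem map_star (φ : Operation A B) (a : A) : φ (star a) = star (φ a) :=
  StarHomClass.map_star φ.toCompletelyPositiveMap a

/-- The composition of two operations. -/
def comp (ψ : Operation B C) (φ : Operation A B) : Operation A C where
  toLinearMap := ψ.toLinearMap ∘ₗ φ.toLinearMap
  map_cstarMatrix_nonneg' k M hM :=
    ψ.map_cstarMatrix_nonneg' k _ (φ.map_cstarMatrix_nonneg' k M hM)
  map_one' := (congrArg ψ φ.map_one').trans ψ.map_one'

/-- A unital *-homomorphism is an operation. -/
def ofStarAlgHom (f : A →⋆ₐ[ℂ] B) : Operation A B where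
  toLinearMap := f.toAlgHom.toLinearMap
  map_cstarMatrix_nonneg' k M hM :=
    CompletelyPositiveMapClass.map_cstarMatrix_nonneg' f k M hM
  map_one' := _root_.map_one f

variable {H : Type*} [NormedAddCommGroup H] [InnerProductSpace ℂ H] [CompleteSpace H]

/-- The matrix with entries `a i* a j` is `Y* Y` for a `Y` whose only nonzero row is `a`, so
complete positivity applies to it. -/
theorem isPositiveKernel (φ : Operation A B) (π : B →⋆ₐ[ℂ] (H →L[ℂ] H)) :
    IsPositiveKernel (π.toAlgHom.toLinearMap ∘ₗ φ.toLinearMap) where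
  map_star a := (congrArg π (φ.map_star a)).trans (StarHomClass.map_star π (φ a))
  nonneg n a x := by
    -- The empty case is separate because `Y` needs a row with index `0`.
    rcases n with _ | n
    · simp
    let Y : CStarMatrix (Fin (n + 1)) (Fin (n + 1)) A :=
      CStarMatrix.ofMatrix fun k j => if k = 0 then a j else 0
    have hYa : ∀ k j, Y k j = if k = 0 then a j else 0 := fun _ _ => rfl
    have hY : ∀ i j, (star Y * Y) i j = star (a i) * a j := fun i j => by
      rw [CStarMatrix.mul_apply, Finset.sum_eq_single 0]
      · rw [CStarMatrix.star_apply, hYa, hYa, if_pos rfl, if_pos rfl]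
      · intro k _ hk
        rw [hYa, if_neg hk, mul_zero]
      · simp
    have h := matrixForm_nonneg π x
      (φ.map_cstarMatrix_nonneg' (n + 1) (star Y * Y) (star_mul_self_nonneg Y))
    simp only [CStarMatrix.map_apply, hY] at h
    exact h

end Basic

/-- **Stinespring's theorem** for an operation followed by a representation. -/
theorem exists_dilation {A B : Type u} [CStarAlgebra A] [CStarAlgebra B] (φ : Operation A B)
    (π : HilbertRep B) : ∃ (σ : HilbertRep A) (V : π.space →ₗᵢ[ℂ] σ.space),
      ∀ a x y, inner ℂ (V x) (σ.hom a (V y)) = inner ℂ x (π.hom (φ a) y) :=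
  have hφ := φ.isPositiveKernel π.hom
  have h1 : (π.hom.toAlgHom.toLinearMap ∘ₗ φ.toLinearMap) 1 = 1 :=
    (congrArg π.hom φ.map_one').trans (map_one π.hom)
  -- With `A` and `B` in one universe, the dilation space lies in the universe that `HilbertRep A`
  -- allows, so it takes part in the supremum defining `minNorm`.
  ⟨{ space := UniformSpace.Completion hφ.PreDilation, hom := hφ.dilationHom },
    hφ.dilationIsometry h1, hφ.inner_dilationIsometry h1⟩

end Operation

/-! ### Tensor products of isometries and compressions. -/

namespace HilbertTensor

variable {H H' : Type u} {K K' : Type v} [NormedAddCommGroup H] [InnerProductSpace ℂ H]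
  [NormedAddCommGroup K] [InnerProductSpace ℂ K] [NormedAddCommGroup H'] [InnerProductSpace ℂ H']
  [NormedAddCommGroup K'] [InnerProductSpace ℂ K']

/-- The tensor product of two isometries of Hilbert spaces. -/
def isometryTensor (V : H →ₗᵢ[ℂ] H') (W : K →ₗᵢ[ℂ] K') :
    HilbertTensor H K →L[ℂ] HilbertTensor H' K' :=
  (TensorProduct.mapIsometry V W).toContinuousLinearMap.completion

theorem isometryTensor_coe (V : H →ₗᵢ[ℂ] H') (W : K →ₗᵢ[ℂ] K') (z : H ⊗[ℂ] K) :
    isometryTensor V W (coe z) = coe (TensorProduct.mapIsometry V W z) :=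
  ContinuousLinearMap.completion_apply_coe
    (TensorProduct.mapIsometry V W).toContinuousLinearMap z

theorem norm_coe (z : H ⊗[ℂ] K) : ‖coe z‖ = ‖z‖ :=
  UniformSpace.Completion.norm_coe z

theorem norm_isometryTensor (V : H →ₗᵢ[ℂ] H') (W : K →ₗᵢ[ℂ] K') (z : HilbertTensor H K) :
    ‖isometryTensor V W z‖ = ‖z‖ := by
  refine denseRange_coe.induction_on z (isClosed_eq (by fun_prop) (by fun_prop)) fun z => ?_
  rw [isometryTensor_coe, norm_coe, norm_coe, LinearIsometry.norm_map]

/-- Matrix coefficients of an elementary tensor of operators that are compressions. -/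
theorem inner_isometryTensor_opTensor (V : H →ₗᵢ[ℂ] H') (W : K →ₗᵢ[ℂ] K') {S : H →L[ℂ] H}
    {S' : H' →L[ℂ] H'} {T : K →L[ℂ] K} {T' : K' →L[ℂ] K'}
    (hS : ∀ x y, inner ℂ (V x) (S' (V y)) = inner ℂ x (S y))
    (hT : ∀ x y, inner ℂ (W x) (T' (W y)) = inner ℂ x (T y)) (z z' : HilbertTensor H K) :
    inner ℂ (isometryTensor V W z) (opTensor S' T' (isometryTensor V W z')) =
      inner ℂ z (opTensor S T z') := by
  refine denseRange_coe.induction_on z (isClosed_eq (by fun_prop) (by fun_prop)) fun z => ?_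
  refine denseRange_coe.induction_on z' (isClosed_eq (by fun_prop) (by fun_prop)) fun z' => ?_
  rw [isometryTensor_coe, isometryTensor_coe]
  induction z using TensorProduct.induction_on with
  | zero => simp
  | add z₁ z₂ h₁ h₂ => simp only [map_add, inner_add_left, h₁, h₂]
  | tmul x y =>
    induction z' using TensorProduct.induction_on with
    | zero => simp
    | add z₁ z₂ h₁ h₂ => simp only [map_add, inner_add_right, h₁, h₂]
    | tmul x' y' =>
      rw [TensorProduct.mapIsometry_apply, TensorProduct.mapIsometry_apply,
        TensorProduct.map_tmul, TensorProduct.map_tmul, opTensor_coe_tmul, opTensor_coe_tmul,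
        inner_coe_tmul, inner_coe_tmul]
      exact congrArg₂ _ (hS x x') (hT y y')

end HilbertTensor

/-! ### Product representations of the minimal tensor product. -/

section MinRep

variable {A : Type u} {B : Type v} [CStarAlgebra A] [CStarAlgebra B]

/-- The extension of `π ⊗ ρ` to a bounded linear map on the minimal tensor product. -/
def minRepL (π : HilbertRep A) (ρ : HilbertRep B) : MinTensor A B →L[ℂ]
    (HilbertTensor π.space ρ.space →L[ℂ] HilbertTensor π.space ρ.space) :=
  (LinearMap.mkContinuous
    ((tensorRep π ρ).toAlgHom.toLinearMap : AlgTensor A B →ₗ[ℂ] _) 1 fun t => by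
      rw [one_mul]
      exact norm_tensorRep_le π ρ t).fromCompletion

theorem minRepL_of (π : HilbertRep A) (ρ : HilbertRep B) (t : AlgTensor A B) :
    minRepL π ρ (MinTensor.of t) = tensorRep π ρ t :=
  ContinuousLinearMap.fromCompletion_apply_coe _ t

/-- The representation `π ⊗ ρ` of the minimal tensor product. -/
def minRep (π : HilbertRep A) (ρ : HilbertRep B) : MinTensor A B →⋆ₐ[ℂ]
    (HilbertTensor π.space ρ.space →L[ℂ] HilbertTensor π.space ρ.space) where
  toFun := minRepL π ρ
  map_one' := (minRepL_of π ρ 1).trans (map_one (tensorRep π ρ))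
  map_mul' s t := by
    refine MinTensor.induction₂ (p := fun s t => minRepL π ρ (s * t) = minRepL π ρ s * minRepL π ρ t)
      s t (isClosed_eq (by fun_prop) (by fun_prop)) fun s t => ?_
    rw [← MinTensor.of_mul, minRepL_of, minRepL_of, minRepL_of]
    exact map_mul (tensorRep π ρ) s t
  map_zero' := map_zero _
  map_add' := map_add _
  commutes' c := by
    rw [Algebra.algebraMap_eq_smul_one, map_smul, Algebra.algebraMap_eq_smul_one]
    exact congrArg (c • ·) ((minRepL_of π ρ 1).trans (map_one (tensorRep π ρ)))
  map_star' t := by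
    refine MinTensor.induction (p := fun t => minRepL π ρ (star t) = star (minRepL π ρ t))
      t (isClosed_eq ((minRepL π ρ).continuous.comp MinTensor.continuous_star)
        (by fun_prop)) fun t => ?_
    rw [MinTensor.star_of, minRepL_of, minRepL_of]
    exact map_star (tensorRep π ρ) t

theorem minRep_of (π : HilbertRep A) (ρ : HilbertRep B) (t : AlgTensor A B) :
    minRep π ρ (MinTensor.of t) = tensorRep π ρ t :=
  minRepL_of π ρ t

theorem continuous_minRep (π : HilbertRep A) (ρ : HilbertRep B) : Continuous (minRep π ρ) :=
  (minRepL π ρ).continuous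

/-- The representations `π ⊗ ρ` are jointly isometric on the minimal tensor product. -/
theorem norm_le_of_minRep {t : MinTensor A B} {M : ℝ} (hM : ∀ π ρ, ‖minRep π ρ t‖ ≤ M)
    (hM0 : 0 ≤ M) : ‖t‖ ≤ M := by
  refine le_of_forall_pos_le_add fun ε hε => ?_
  -- The bound is known by definition only on algebraic tensors. Half of `ε` pays for the distance
  -- to `s`, and half for the change in `minRep π ρ`, which is contractive.
  obtain ⟨s, hs⟩ : ∃ s : AlgTensor A B, ‖t - MinTensor.of s‖ < ε / 2 := by
    obtain ⟨s, hs⟩ := (UniformSpace.Completion.denseRange_coe (α := AlgTensor A B)).exists_dist_lt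
      t (half_pos hε)
    exact ⟨s, by rwa [← dist_eq_norm]⟩
  have h1 : ‖MinTensor.of s‖ ≤ M + ε / 2 := by
    rw [MinTensor.norm_of]
    refine minNorm_le (by positivity) fun π ρ => ?_
    have h2 : tensorRep π ρ s = minRep π ρ t - minRep π ρ (t - MinTensor.of s) := by
      rw [map_sub, sub_sub_cancel]
      exact (minRep_of π ρ s).symm
    rw [h2]
    refine (norm_sub_le _ _).trans (add_le_add (hM π ρ) ?_)
    exact (NonUnitalStarAlgHom.norm_apply_le (minRep π ρ) _).trans hs.le
  calc ‖t‖ = ‖(t - MinTensor.of s) + MinTensor.of s‖ := by rw [sub_add_cancel]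
    _ ≤ ε / 2 + (M + ε / 2) := (norm_add_le _ _).trans (add_le_add hs.le h1)
    _ = M + ε := by ring

theorem eq_zero_of_minRep {t : MinTensor A B} (h : ∀ π ρ, minRep π ρ t = 0) : t = 0 :=
  norm_le_zero_iff.mp (norm_le_of_minRep (fun π ρ => by rw [h, norm_zero]) le_rfl)

/-- Positivity of matrices over the minimal tensor product is detected by the representations
`π ⊗ ρ`. -/
theorem minTensor_matrix_nonneg {n : Type*} [Fintype n] {M : CStarMatrix n n (MinTensor A B)}
    (h : ∀ (π : HilbertRep A) (ρ : HilbertRep B) (x : n → HilbertTensor π.space ρ.space),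
      0 ≤ matrixFunctional (minRep π ρ) x M) : 0 ≤ M := by
  refine nonneg_of_forall_functional
    (ι := Σ p : HilbertRep A × HilbertRep B, n → HilbertTensor p.1.space p.2.space)
    (fun i => matrixFunctional (minRep i.1.1 i.1.2) i.2) ?_ ?_ fun i => h _ _ _
  · rintro ⟨p, x⟩ Y
    exact ⟨⟨p, fun i => ∑ k, minRep p.1 p.2 (Y i k) (x k)⟩, fun N =>
      (matrixForm_star_mul (minRep p.1 p.2) x N Y).symm⟩
  · intro N hN
    ext i j
    exact eq_zero_of_minRep fun π ρ =>
      matrix_eq_zero_of_matrixFunctional (minRep π ρ) (fun x => hN ⟨(π, ρ), x⟩) i j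

end MinRep

/-! ### The tensor product of two operations. -/

namespace Operation

section Tensor

variable {A A' : Type u} {B B' : Type v} [CStarAlgebra A] [CStarAlgebra A'] [CStarAlgebra B]
  [CStarAlgebra B']

/-- By linearity in `t`, the compression identities for `α` and `β` multiply on elementary tensors.
-/
theorem inner_tensorRep_map (α : Operation A A') (β : Operation B B') {π : HilbertRep A'}
    {ρ : HilbertRep B'} {σ : HilbertRep A} {τ : HilbertRep B} {V : π.space →ₗᵢ[ℂ] σ.space}
    {W : ρ.space →ₗᵢ[ℂ] τ.space}
    (hV : ∀ a x y, inner ℂ (V x) (σ.hom a (V y)) = inner ℂ x (π.hom (α a) y))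
    (hW : ∀ b x y, inner ℂ (W x) (τ.hom b (W y)) = inner ℂ x (ρ.hom (β b) y))
    (t : A ⊗[ℂ] B) (z z' : HilbertTensor π.space ρ.space) :
    inner ℂ (HilbertTensor.isometryTensor V W z)
        (tensorRep σ τ t (HilbertTensor.isometryTensor V W z')) =
      inner ℂ z (tensorRep π ρ (TensorProduct.map α.toLinearMap β.toLinearMap t) z') := by
  induction t using TensorProduct.induction_on with
  | zero => simp
  | add s t hs ht =>
    rw [map_add, map_add, map_add, add_apply, add_apply, inner_add_right, inner_add_right, hs, ht]
  | tmul a b =>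
    rw [TensorProduct.map_tmul, tensorRep_tmul, tensorRep_tmul]
    exact HilbertTensor.inner_isometryTensor_opTensor V W (hV a) (hW b) z z'

theorem minNorm_map_le (α : Operation A A') (β : Operation B B') (t : A ⊗[ℂ] B) :
    minNorm (TensorProduct.map α.toLinearMap β.toLinearMap t) ≤ minNorm t := by
  refine minNorm_le (minNorm_nonneg t) fun π ρ => ?_
  obtain ⟨σ, V, hV⟩ := α.exists_dilation π
  obtain ⟨τ, W, hW⟩ := β.exists_dilation ρ
  refine ContinuousLinearMap.opNorm_le_bound _ (minNorm_nonneg t) fun z => ?_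
  set S := tensorRep π ρ (TensorProduct.map α.toLinearMap β.toLinearMap t)
  -- Pairing `S z` with itself turns `S` into a compression of `(σ ⊗ τ)(t)` by an isometry; one
  -- factor `‖S z‖` is cancelled at the end.
  have h : ‖S z‖ * ‖S z‖ ≤ ‖S z‖ * (minNorm t * ‖z‖) :=
    calc ‖S z‖ * ‖S z‖ = ‖(inner ℂ (S z) (S z) : ℂ)‖ := by
          rw [inner_self_eq_norm_sq_to_K]; simp [sq]
      _ ≤ ‖S z‖ * (minNorm t * ‖z‖) := by
        rw [← inner_tensorRep_map α β hV hW]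
        refine (norm_inner_le_norm _ _).trans ?_
        rw [HilbertTensor.norm_isometryTensor]
        refine mul_le_mul_of_nonneg_left ?_ (norm_nonneg _)
        refine (ContinuousLinearMap.le_opNorm _ _).trans ?_
        rw [HilbertTensor.norm_isometryTensor]
        exact mul_le_mul_of_nonneg_right (norm_tensorRep_le σ τ t) (norm_nonneg z)
  rcases (norm_nonneg (S z)).eq_or_lt with h0 | h0
  · rw [← h0]
    exact mul_nonneg (minNorm_nonneg t) (norm_nonneg z)
  · exact le_of_mul_le_mul_left h h0

/-- The tensor product of two operations, as a bounded linear map. -/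
def tensorL (α : Operation A A') (β : Operation B B') : MinTensor A B →L[ℂ] MinTensor A' B' :=
  (LinearMap.mkContinuous
    (TensorProduct.map α.toLinearMap β.toLinearMap : AlgTensor A B →ₗ[ℂ] AlgTensor A' B') 1
      fun t => by
        rw [one_mul]
        exact minNorm_map_le α β t).completion

theorem tensorL_of (α : Operation A A') (β : Operation B B') (t : AlgTensor A B) :
    tensorL α β (MinTensor.of t) =
      MinTensor.of (TensorProduct.map α.toLinearMap β.toLinearMap t : A' ⊗[ℂ] B') :=
  ContinuousLinearMap.completion_apply_coe _ t

theorem inner_minRep_tensorL (α : Operation A A') (β : Operation B B') {π : HilbertRep A'}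
    {ρ : HilbertRep B'} {σ : HilbertRep A} {τ : HilbertRep B} {V : π.space →ₗᵢ[ℂ] σ.space}
    {W : ρ.space →ₗᵢ[ℂ] τ.space}
    (hV : ∀ a x y, inner ℂ (V x) (σ.hom a (V y)) = inner ℂ x (π.hom (α a) y))
    (hW : ∀ b x y, inner ℂ (W x) (τ.hom b (W y)) = inner ℂ x (ρ.hom (β b) y))
    (t : MinTensor A B) (z z' : HilbertTensor π.space ρ.space) :
    inner ℂ (HilbertTensor.isometryTensor V W z)
        (minRep σ τ t (HilbertTensor.isometryTensor V W z')) =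
      inner ℂ z (minRep π ρ (tensorL α β t) z') := by
  have hσ := continuous_minRep σ τ
  have hπ := continuous_minRep π ρ
  refine MinTensor.induction (p := fun t => inner ℂ (HilbertTensor.isometryTensor V W z)
        (minRep σ τ t (HilbertTensor.isometryTensor V W z')) =
      inner ℂ z (minRep π ρ (tensorL α β t) z')) t
    (isClosed_eq (by fun_prop) (by fun_prop)) fun t => ?_
  rw [tensorL_of, minRep_of]
  refine Eq.trans ?_ (congrArg (fun S => inner ℂ z (S z')) (minRep_of π ρ _).symm)
  exact inner_tensorRep_map α β hV hW t z z'

/-- The tensor product of two operations. -/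
def tensor (α : Operation A A') (β : Operation B B') :
    Operation (MinTensor A B) (MinTensor A' B') where
  toLinearMap := (tensorL α β).toLinearMap
  map_cstarMatrix_nonneg' k M hM := by
    -- Each form of the image matrix is the form of `M` under `σ ⊗ τ` at the vectors `(V ⊗ W) (x
    -- i)`.
    refine minTensor_matrix_nonneg fun π ρ x => ?_
    obtain ⟨σ, V, hV⟩ := α.exists_dilation π
    obtain ⟨τ, W, hW⟩ := β.exists_dilation ρ
    have h := matrixForm_nonneg (minRep σ τ)
      (fun i => HilbertTensor.isometryTensor V W (x i)) hM
    simp only [inner_minRep_tensorL α β hV hW] at h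
    exact h
  map_one' := by
    refine (tensorL_of α β 1).trans (congrArg MinTensor.of ?_)
    exact (TensorProduct.map_tmul _ _ _ _).trans (congrArg₂ _ α.map_one' β.map_one')

theorem tensor_inl (α : Operation A A') (β : Operation B B') (a : A) :
    tensor α β (MinTensor.inl A B a) = MinTensor.inl A' B' (α a) := by
  refine (tensorL_of α β _).trans (congrArg MinTensor.of ?_)
  exact (TensorProduct.map_tmul _ _ _ _).trans (congrArg (α a ⊗ₜ[ℂ] ·) β.map_one')

theorem tensor_inr (α : Operation A A') (β : Operation B B') (b : B) :
    tensor α β (MinTensor.inr A B b) = MinTensor.inr A' B' (β b) := by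
  refine (tensorL_of α β _).trans (congrArg MinTensor.of ?_)
  exact (TensorProduct.map_tmul _ _ _ _).trans (congrArg (· ⊗ₜ[ℂ] β b) α.map_one')

end Tensor

end Operation

/-! ### Enough positive functionals and representations. -/

section States

variable {A : Type u} [CStarAlgebra A]

/-- Hahn–Banach separates `-b` from the closed cone of positive elements. -/
theorem exists_positive_functional {b : A} (hb : 0 ≤ b) (hb0 : b ≠ 0) :
    ∃ f : A →ₚ[ℂ] ℂ, f b ≠ 0 := by
  let C : ProperCone ℝ A :=
    { carrier := {a | 0 ≤ a}
      add_mem' := fun {a b} ha hb => show 0 ≤ a + b from add_nonneg ha hb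
      zero_mem' := show (0 : A) ≤ 0 from le_rfl
      smul_mem' := fun c a ha => show 0 ≤ (c : ℝ) • a from smul_nonneg c.2 ha
      isClosed' := CStarAlgebra.isClosed_nonneg }
  have hmem : -b ∉ C := fun h => hb0 (le_antisymm (neg_nonneg.mp h) hb)
  obtain ⟨g, hg, hgb⟩ := C.hyperplane_separation_point hmem
  -- Taking real parts first makes the complexification agree with `g` on positive `a`: there `i a`
  -- has real part zero, whereas `g (i a)` itself need not vanish.
  let r : Module.Dual ℝ A := g.toLinearMap ∘ₗ (selfAdjoint.submodule ℝ A).subtype ∘ₗ realPart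
  have hr : ∀ a : A, 0 ≤ a → Module.Dual.extendRCLike (𝕜 := ℂ) r a = (g a : ℂ) := fun a ha => by
    have h1 : r a = g a := congrArg g (IsSelfAdjoint.of_nonneg ha).coe_realPart
    have h2 : r (Complex.I • a) = 0 := by
      change g (realPart (Complex.I • a) : A) = 0
      rw [realPart_I_smul, (IsSelfAdjoint.of_nonneg ha).imaginaryPart]
      simp
    rw [Module.Dual.extendRCLike_apply, h1]
    simp [h2]
  refine ⟨PositiveLinearMap.mk₀ (Module.Dual.extendRCLike r) fun a ha => ?_, fun h => ?_⟩
  · rw [hr a ha]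
    exact Complex.zero_le_real.mpr (hg a ha)
  · have h3 : (g b : ℂ) = 0 := (hr b hb).symm.trans h
    rw [map_neg, Complex.ofReal_eq_zero.mp h3, neg_zero] at hgb
    exact hgb.false

/-- A nonzero element of a C*-algebra is nonzero in some representation. -/
theorem exists_hilbertRep {a : A} (ha : a ≠ 0) : ∃ π : HilbertRep A, π.hom a ≠ 0 := by
  obtain ⟨f, hf⟩ := exists_positive_functional (star_mul_self_nonneg a)
    ((CStarRing.star_mul_self_eq_zero_iff a).not.mpr ha)
  -- In the GNS representation, the vector of `1` is sent by `a` to a vector of squared norm `f (a*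
  -- a)`.
  refine ⟨{ space := f.GNS, hom := f.gnsStarAlgHom }, fun h => hf ?_⟩
  have h1 : f.gnsStarAlgHom a (f.toPreGNS 1 : f.GNS) = 0 := by
    rw [h]; rfl
  replace h1 := (PositiveLinearMap.gnsNonUnitalStarAlgHom_apply_coe f).symm.trans h1
  rw [← norm_eq_zero, UniformSpace.Completion.norm_coe] at h1
  have h2 := PositiveLinearMap.preGNS_norm_sq f (f.leftMulMapPreGNS a (f.toPreGNS 1))
  rw [h1] at h2
  simpa using h2.symm

end States

/-! ### Injectivity of the two canonical embeddings. -/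

namespace MinTensor

variable {A : Type u} {B : Type v} [CStarAlgebra A] [CStarAlgebra B]

/-- Choose `π`, `ρ` and vectors with `π(a) x` and `ρ(b) y` nonzero; the norm of their tensor is the
product of their norms. -/
theorem of_tmul_ne_zero {a : A} {b : B} (ha : a ≠ 0) (hb : b ≠ 0) :
    (of (a ⊗ₜ[ℂ] b : A ⊗[ℂ] B) : MinTensor A B) ≠ 0 := by
  intro h
  obtain ⟨π, hπ⟩ := exists_hilbertRep ha
  obtain ⟨ρ, hρ⟩ := exists_hilbertRep hb
  obtain ⟨x, hx⟩ := DFunLike.ne_iff.mp hπ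
  obtain ⟨y, hy⟩ := DFunLike.ne_iff.mp hρ
  have h1 : minRep π ρ (of (a ⊗ₜ[ℂ] b : A ⊗[ℂ] B)) (HilbertTensor.coe (x ⊗ₜ[ℂ] y)) = 0 := by
    rw [h, map_zero]; rfl
  have h2 := (HilbertTensor.opTensor_coe_tmul (π.hom a) (ρ.hom b) x y).symm.trans
    ((congrArg (· (HilbertTensor.coe (x ⊗ₜ[ℂ] y)))
      (minRep_of π ρ (a ⊗ₜ[ℂ] b : A ⊗[ℂ] B)).symm).trans h1)
  have h3 := HilbertTensor.norm_coe (π.hom a x ⊗ₜ[ℂ] ρ.hom b y)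
  rw [h2, norm_zero, TensorProduct.norm_tmul] at h3
  rcases mul_eq_zero.mp h3.symm with h | h
  · exact hx (norm_eq_zero.mp h)
  · exact hy (norm_eq_zero.mp h)

theorem inl_injective [Nontrivial B] : Function.Injective (inl A B) :=
  (injective_iff_map_eq_zero _).mpr fun _ h => by_contra fun ha => of_tmul_ne_zero ha one_ne_zero h

theorem inr_injective [Nontrivial A] : Function.Injective (inr A B) :=
  (injective_iff_map_eq_zero _).mpr fun _ h => by_contra fun hb => of_tmul_ne_zero one_ne_zero hb h

theorem subsingleton_of_left [Subsingleton A] : Subsingleton (MinTensor A B) :=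
  subsingleton_of_zero_eq_one <| by
    rw [← map_one (inl A B), Subsingleton.elim (1 : A) 0, map_zero]

theorem subsingleton_of_right [Subsingleton B] : Subsingleton (MinTensor A B) :=
  subsingleton_of_zero_eq_one <| by
    rw [← map_one (inr A B), Subsingleton.elim (1 : B) 0, map_zero]

end MinTensor

/-! ### Extension to the injective algebra and independence. -/

section Independence

variable {A : Type u} {B : Type v} {C : Type w} [CStarAlgebra A] [CStarAlgebra B] [CStarAlgebra C]

theorem isClosed_range {f : A →⋆ₐ[ℂ] C} (hf : Function.Injective f) :
    IsClosed (f.range : Set C) := by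
  exact (NonUnitalStarAlgHom.isometry f hf).isClosedEmbedding.isClosed_range

/-- In an injective C*-algebra, an operation on an embedded C*-algebra of any universe extends to
the ambient algebra. -/
theorem IsOpInjective.exists_extension (hC : IsOpInjective C) {j : A →⋆ₐ[ℂ] C}
    (hj : Function.Injective j) (φ : Operation A C) :
    ∃ ψ : Operation C C, ∀ a, ψ (j a) = φ a := by
  -- Closedness makes the range a C*-algebra. Unlike `A`, it lives in the universe of `C`, over
  -- which `IsOpInjective` quantifies.
  have := isClosed_range hj
  let e : A ≃⋆ₐ[ℂ] j.range := StarAlgEquiv.ofInjective j hj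
  obtain ⟨ψ, hψ⟩ := hC j.range j.range.subtype Subtype.val_injective
    (φ.comp (Operation.ofStarAlgHom (e.symm : j.range →⋆ₐ[ℂ] A)))
  refine ⟨ψ, fun a => (hψ (e a)).trans ?_⟩
  exact congrArg φ (e.symm_apply_apply a)

/-- The joint extension is an extension of `j ∘ (α ⊗ β)` along `j`. -/
theorem opIndependentHoms_of_isOpInjective (hC : IsOpInjective C) {j : MinTensor A B →⋆ₐ[ℂ] C}
    (hj : Function.Injective j) :
    OpIndependentHoms (j.comp (MinTensor.inl A B)) (j.comp (MinTensor.inr A B)) := by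
  intro α β
  obtain ⟨γ, hγ⟩ := hC.exists_extension hj ((Operation.ofStarAlgHom j).comp (α.tensor β))
  exact ⟨γ, fun a => (hγ _).trans (congrArg j (Operation.tensor_inl α β a)),
    fun b => (hγ _).trans (congrArg j (Operation.tensor_inr α β b))⟩

/-- Independence does not depend on the representatives of the subobjects. -/
theorem OpIndependentHoms.congr {D₁ D₂ : Type*} [CStarAlgebra D₁] [CStarAlgebra D₂]
    {f : A →⋆ₐ[ℂ] C} {g : B →⋆ₐ[ℂ] C} (h : OpIndependentHoms f g) (k₁ : D₁ ≃⋆ₐ[ℂ] A)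
    (k₂ : D₂ ≃⋆ₐ[ℂ] B) {g₁ : D₁ →⋆ₐ[ℂ] C} {g₂ : D₂ →⋆ₐ[ℂ] C} (h₁ : ∀ d, f (k₁ d) = g₁ d)
    (h₂ : ∀ d, g (k₂ d) = g₂ d) : OpIndependentHoms g₁ g₂ := by
  intro α β
  obtain ⟨γ, hγ₁, hγ₂⟩ := h
    ((Operation.ofStarAlgHom (k₁ : D₁ →⋆ₐ[ℂ] A)).comp
      (α.comp (Operation.ofStarAlgHom (k₁.symm : A →⋆ₐ[ℂ] D₁))))
    ((Operation.ofStarAlgHom (k₂ : D₂ →⋆ₐ[ℂ] B)).comp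
      (β.comp (Operation.ofStarAlgHom (k₂.symm : B →⋆ₐ[ℂ] D₂))))
  refine ⟨γ, fun d => ?_, fun d => ?_⟩
  · rw [← h₁, ← h₁, hγ₁]
    exact congrArg (fun z => f (k₁ (α z))) (k₁.symm_apply_apply d)
  · rw [← h₂, ← h₂, hγ₂]
    exact congrArg (fun z => g (k₂ (β z))) (k₂.symm_apply_apply d)

theorem opIndependentHoms_of_subsingleton [Subsingleton C] (f : A →⋆ₐ[ℂ] C) (g : B →⋆ₐ[ℂ] C) :
    OpIndependentHoms f g := fun _ _ =>
  ⟨Operation.ofStarAlgHom (StarAlgHom.id ℂ C), fun _ => Subsingleton.elim _ _,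
    fun _ => Subsingleton.elim _ _⟩

theorem subsingleton_of_starAlgHom [Subsingleton A] (f : A →⋆ₐ[ℂ] C) : Subsingleton C :=
  subsingleton_of_zero_eq_one <| by
    rw [← map_one f, Subsingleton.elim (1 : A) 0, map_zero]

end Independence

end CStarIndep

end

/-! ### The corollary, including zero algebras. -/

/-- If `C` is an injective C*-algebra and the minimal tensor product `A ⊗ B` is a C*-subalgebra of
`C` (embedded by `j`), then the C*-subalgebras `A ⊗ 1` and `1 ⊗ B` of `C` are independent with
respect to operations; moreover any two operations on `A` and `B` themselves have a joint extension
to `C`, and `A ≅ A ⊗ 1`, `B ≅ 1 ⊗ B` if `A` and `B` are nonzero. -/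
theorem mainTheorem3 {A : Type u} {B : Type v} {C : Type w}
    [CStarAlgebra A] [CStarAlgebra B] [CStarAlgebra C]
    (hC : CStarIndep.IsOpInjective C)
    (j : CStarIndep.MinTensor A B →⋆ₐ[ℂ] C) (hj : Function.Injective j) :
    CStarIndep.OpIndependent
        (j.comp (CStarIndep.MinTensor.inl A B)).range
        (j.comp (CStarIndep.MinTensor.inr A B)).range ∧
      CStarIndep.OpIndependentHoms
        (j.comp (CStarIndep.MinTensor.inl A B))
        (j.comp (CStarIndep.MinTensor.inr A B)) ∧
      (Nontrivial A → Nontrivial B →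
        Function.Injective (j.comp (CStarIndep.MinTensor.inl A B)) ∧
        Function.Injective (j.comp (CStarIndep.MinTensor.inr A B))) := by
  have hind := CStarIndep.opIndependentHoms_of_isOpInjective hC hj
  have hinl : Nontrivial B → Function.Injective (j.comp (CStarIndep.MinTensor.inl A B)) :=
    fun _ => hj.comp CStarIndep.MinTensor.inl_injective
  have hinr : Nontrivial A → Function.Injective (j.comp (CStarIndep.MinTensor.inr A B)) :=
    fun _ => hj.comp CStarIndep.MinTensor.inr_injective
  refine ⟨?_, hind, fun hA hB => ⟨hinl hB, hinr hA⟩⟩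
  -- If one factor is zero, the other need not embed in the tensor product, so the transport along
  -- `A ≅ A ⊗ 1` and `B ≅ 1 ⊗ B` is unavailable; but `1 = j 1 = 0` in `C`.
  have htriv : Subsingleton (CStarIndep.MinTensor A B) → CStarIndep.OpIndependent
      (j.comp (CStarIndep.MinTensor.inl A B)).range
      (j.comp (CStarIndep.MinTensor.inr A B)).range := fun _ =>
    have : Subsingleton C := CStarIndep.subsingleton_of_starAlgHom j
    ⟨(Set.toFinite _).isClosed, (Set.toFinite _).isClosed, fun _ _ _ _ g₁ g₂ _ _ _ _ =>
      CStarIndep.opIndependentHoms_of_subsingleton g₁ g₂⟩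
  rcases subsingleton_or_nontrivial A with _ | hA
  · exact htriv CStarIndep.MinTensor.subsingleton_of_left
  rcases subsingleton_or_nontrivial B with _ | hB
  · exact htriv CStarIndep.MinTensor.subsingleton_of_right
  refine ⟨CStarIndep.isClosed_range (hinl hB), CStarIndep.isClosed_range (hinr hA), ?_⟩
  rintro D₁ D₂ _ _ g₁ g₂ - - ⟨h₁, hg₁⟩ ⟨h₂, hg₂⟩
  let e₁ := StarAlgEquiv.ofInjective _ (hinl hB)
  let e₂ := StarAlgEquiv.ofInjective _ (hinr hA)
  -- Each representative of the subobject is identified with `A` or `B` through the range, which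
  -- reduces independence to the two homomorphisms in `hind`.
  refine hind.congr (h₁.trans e₁.symm) (h₂.trans e₂.symm) (fun d => ?_) fun d => ?_
  · exact (congrArg Subtype.val (e₁.apply_symm_apply (h₁ d))).trans (hg₁ d)
  · exact (congrArg Subtype.val (e₂.apply_symm_apply (h₂ d))).trans (hg₂ d)
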